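/- Let $k$ be a field and let $G$ be a finite simple graph on $n$ vertices having at least one edge. Let $S$ be the polynomial ring over $k$ whose variables are the vertices of $G$, and let $I(G) = (xy : (x,y) \text{ is an edge of } G) \subseteq S$ be the edge ideal of $G$. Define the degree of an edge $(x,y)$ of $G$ to be $\deg(x)+\deg(y)-|A|$, where $A$ is the set of common neighbours of $x$ and $y$ (equivalently, the number of vertices adjacent to $x$ or to $y$), and let $D$ be the maximum degree of an edge of $G$. Then the projective dimension of the $S$-module $S/I(G)$ is finite and satisfies $$\operatorname{pd}(S/I(G)) \le n\left(1-\frac{1}{D}\right).$$ The bound is sharp for complete bipartite graphs: for all integers $a, b \ge 1$ and $G = K_{a,b}$ one has $n = a+b$, $D = a+b$ and $$\operatorname{pd}(S/I(G)) = n\left(1-\frac{1}{D}\right) = a+b-1.$$ -/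

import Mathlib

/-- The edge ideal `I(G) = (xy : (x, y) is an edge of G)` in the polynomial ring `k[V]`. -/
noncomputable def SimpleGraph.edgeIdeal {V : Type*} (G : SimpleGraph V) (k : Type*) [CommSemiring k] :
    Ideal (MvPolynomial V k) :=
  Ideal.span {m | ∃ x y : V, G.Adj x y ∧ m = MvPolynomial.X x * MvPolynomial.X y}

/-- The degree of an edge `(x, y)`: `deg x + deg y` minus the number of common neighbours. -/
def SimpleGraph.edgeDegree {V : Type*} [Fintype V] [DecidableEq V] (G : SimpleGraph V)
    [DecidableRel G.Adj] (x y : V) : ℕ :=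
  G.degree x + G.degree y - (G.neighborFinset x ∩ G.neighborFinset y).card

/-- The subtraction never truncates: the degree of `(x, y)` is the number of vertices
adjacent to `x` or to `y`. -/
theorem SimpleGraph.edgeDegree_eq_card_union {V : Type*} [Fintype V] [DecidableEq V]
    (G : SimpleGraph V) [DecidableRel G.Adj] (x y : V) :
    G.edgeDegree x y = (G.neighborFinset x ∪ G.neighborFinset y).card := by
  rw [SimpleGraph.edgeDegree, Finset.card_union, SimpleGraph.card_neighborFinset_eq_degree,
    SimpleGraph.card_neighborFinset_eq_degree]

/-- `D` is the maximum degree of an edge of `G`; in particular `G` has an edge. -/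
def SimpleGraph.IsMaxEdgeDegree {V : Type*} [Fintype V] [DecidableEq V] (G : SimpleGraph V)
    [DecidableRel G.Adj] (D : ℕ) : Prop :=
  IsGreatest {d : ℕ | ∃ x y : V, G.Adj x y ∧ d = G.edgeDegree x y} D

/-- The projective dimension of `S / I(G)` over the polynomial ring `S = k[V]`. -/
noncomputable def SimpleGraph.pdEdgeIdealQuotient {V : Type*} (G : SimpleGraph V) (k : Type*)
    [Field k] : WithBot ℕ∞ :=
  CategoryTheory.projectiveDimension
    (ModuleCat.of (MvPolynomial V k) (MvPolynomial V k ⧸ G.edgeIdeal k))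

/-! For disjoint vertex sets `A`, `W`, let I(A, W) be generated by the variables in `A` and the
edges inside `W`. By induction on |W|, pd S/I(A, W) ≤ |A| + |W| - |W|/D; the upper bound is the case
A = ∅, W = V. Pick x in W and move its neighbours v in W one at a time into A, using 0 → S/(I : v) →
S/I → S/(I, v) → 0. Passing to the colon ideal puts the remaining neighbours of v into A and loses
v: |A| + |W| drops by at least 1, while W has lost in total only vertices of N(x) ∪ N(v), at most D
of them. Once all neighbours of x are moved, x is isolated and is dropped, with the same accounting.
For K_{a,b} the edge ideal is the intersection of the two ideals of variables of the sides. Their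
sum is the ideal m of all variables, with Ext^{a+b}(S/m, S/m) ≠ 0, so Mayer–Vietoris forces pd ≥ a +
b - 1. -/

open CategoryTheory Abelian

universe u

/-! ### Short exact sequences of cyclic modules. -/

namespace Ideal

variable {R : Type u} [CommRing R]

/-- Multiplication by `r` as a map `R ⧸ J → R ⧸ I`, where `J = (I : r)`. -/
def colonMulMap (I J : Ideal R) (r : R) (h : ∀ p, r * p ∈ I ↔ p ∈ J) : (R ⧸ J) →ₗ[R] (R ⧸ I) :=
  Submodule.mapQ J I (LinearMap.mulLeft R r) fun p hp => by simpa using (h p).2 hp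

/-- The short complex `R ⧸ (I : r) → R ⧸ I → R ⧸ (I + (r))`. -/
noncomputable abbrev colonShortComplex (I J : Ideal R) (r : R) (h : ∀ p, r * p ∈ I ↔ p ∈ J) :
    ShortComplex (ModuleCat.{u} R) :=
  ShortComplex.mk (ModuleCat.ofHom (colonMulMap I J r h))
    (ModuleCat.ofHom (Submodule.factor (le_sup_left : I ≤ I ⊔ Ideal.span {r}))) (by
      refine ModuleCat.hom_ext (LinearMap.ext fun x => ?_)
      obtain ⟨x, rfl⟩ := Submodule.Quotient.mk_surjective _ x
      exact (Submodule.Quotient.mk_eq_zero _).2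
        (mem_sup_right (mul_mem_right _ _ (mem_span_singleton_self r))))

theorem colonShortComplex_shortExact (I J : Ideal R) (r : R) (h : ∀ p, r * p ∈ I ↔ p ∈ J) :
    (colonShortComplex I J r h).ShortExact where
  exact := by
    rw [ShortComplex.moduleCat_exact_iff]
    intro x hx
    obtain ⟨x, rfl⟩ := Submodule.Quotient.mk_surjective _ x
    obtain ⟨i, hi, y, hy, rfl⟩ := Submodule.mem_sup.1 ((Submodule.Quotient.mk_eq_zero _).1 hx)
    obtain ⟨a, rfl⟩ := mem_span_singleton'.1 hy
    refine ⟨Submodule.Quotient.mk a, (Submodule.Quotient.eq I).2 ?_⟩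
    have : r * a - (i + a * r) = -i := by ring
    simpa [this] using hi
  mono_f := by
    rw [ModuleCat.mono_iff_injective]
    refine (injective_iff_map_eq_zero (colonMulMap I J r h)).2 fun x hx => ?_
    obtain ⟨x, rfl⟩ := Submodule.Quotient.mk_surjective _ x
    exact (Submodule.Quotient.mk_eq_zero _).2
      ((h x).1 ((Submodule.Quotient.mk_eq_zero _).1 hx))
  epi_g := by
    rw [ModuleCat.epi_iff_surjective]
    exact Submodule.factor_surjective (le_sup_left : I ≤ I ⊔ Ideal.span {r})

theorem hasProjectiveDimensionLT_quotient_of_colon {I J : Ideal R} {r : R}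
    (h : ∀ p, r * p ∈ I ↔ p ∈ J) (n : ℕ)
    (h₁ : HasProjectiveDimensionLT (ModuleCat.of R (R ⧸ J)) n)
    (h₂ : HasProjectiveDimensionLT (ModuleCat.of R (R ⧸ (I ⊔ Ideal.span {r}))) n) :
    HasProjectiveDimensionLT (ModuleCat.of R (R ⧸ I)) n :=
  (colonShortComplex_shortExact I J r h).hasProjectiveDimensionLT_X₂ n h₁ h₂

theorem hasProjectiveDimensionLT_quotient_sup_span_singleton {I : Ideal R} {r : R}
    (h : ∀ p, r * p ∈ I ↔ p ∈ I) (n : ℕ)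
    (h₁ : HasProjectiveDimensionLT (ModuleCat.of R (R ⧸ I)) n) :
    HasProjectiveDimensionLT (ModuleCat.of R (R ⧸ (I ⊔ Ideal.span {r}))) (n + 1) :=
  (colonShortComplex_shortExact I I r h).hasProjectiveDimensionLT_X₃ n h₁
    (hasProjectiveDimensionLT_of_ge _ n _ (Nat.le_succ n))

/-- The connecting map Ext^n → Ext^{n+1} is injective: its kernel is the image of multiplication by
`r`, which is zero because `r` kills `N`. -/
theorem nontrivial_ext_quotient_sup_span_singleton {I : Ideal R} {r : R}
    (h : ∀ p, r * p ∈ I ↔ p ∈ I) (N : ModuleCat.{u} R) (hN : r • 𝟙 N = 0) (n : ℕ)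
    (h₁ : Nontrivial (Ext (ModuleCat.of R (R ⧸ I)) N n)) :
    Nontrivial (Ext (ModuleCat.of R (R ⧸ (I ⊔ Ideal.span {r}))) N (n + 1)) := by
  have hS := colonShortComplex_shortExact I I r h
  obtain ⟨e, he⟩ := exists_ne (0 : Ext (ModuleCat.of R (R ⧸ I)) N n)
  refine ⟨hS.extClass.comp e (add_comm 1 n), 0, fun h0 => he ?_⟩
  obtain ⟨e', rfl⟩ := Ext.contravariant_sequence_exact₁ hS N e (add_comm 1 n) h0
  have hf : (colonShortComplex I I r h).f = r • 𝟙 (ModuleCat.of R (R ⧸ I)) := by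
    refine ModuleCat.hom_ext (LinearMap.ext fun x => ?_)
    obtain ⟨x, rfl⟩ := Submodule.Quotient.mk_surjective _ x
    rfl
  have : r • e' = 0 := by
    rw [Ext.smul_eq_comp_mk₀, hN, Ext.mk₀_zero, Ext.comp_zero]
  rw [hf, Ext.mk₀_smul, Ext.smul_comp, Ext.mk₀_id_comp, this]

theorem hasProjectiveDimensionLT_quotient_bot :
    HasProjectiveDimensionLT (ModuleCat.of R (R ⧸ (⊥ : Ideal R))) 1 := by
  rw [← projective_iff_hasProjectiveDimensionLT_one, ← IsProjective.iff_projective]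
  exact Module.Projective.of_equiv (Submodule.quotEquivOfEqBot (⊥ : Ideal R) rfl).symm

theorem _root_.ModuleCat.hasProjectiveDimensionLT_prod {M N : Type u} [AddCommGroup M] [Module R M]
    [AddCommGroup N] [Module R N] (n : ℕ) (hM : HasProjectiveDimensionLT (ModuleCat.of R M) n)
    (hN : HasProjectiveDimensionLT (ModuleCat.of R N) n) :
    HasProjectiveDimensionLT (ModuleCat.of R (M × N)) n :=
  hasProjectiveDimensionLT_of_iso (ModuleCat.biprodIsoProd (ModuleCat.of R M) (ModuleCat.of R N)) n

/-- The Mayer–Vietoris short complex `R ⧸ (I ∩ J) → R ⧸ I × R ⧸ J → R ⧸ (I + J)`. -/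
noncomputable abbrev infSupShortComplex (I J : Ideal R) : ShortComplex (ModuleCat.{u} R) :=
  ShortComplex.mk
    (ModuleCat.ofHom ((Submodule.factor (inf_le_left : I ⊓ J ≤ I)).prod
      (Submodule.factor (inf_le_right : I ⊓ J ≤ J))))
    (ModuleCat.ofHom ((Submodule.factor (le_sup_left : I ≤ I ⊔ J)).coprod
      (-(Submodule.factor (le_sup_right : J ≤ I ⊔ J))))) (by
      refine ModuleCat.hom_ext (LinearMap.ext fun x => ?_)
      obtain ⟨x, rfl⟩ := Submodule.Quotient.mk_surjective _ x
      simp)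

theorem infSupShortComplex_shortExact (I J : Ideal R) : (infSupShortComplex I J).ShortExact where
  exact := by
    rw [ShortComplex.moduleCat_exact_iff]
    rintro ⟨x, y⟩ hxy
    obtain ⟨x, rfl⟩ := Submodule.Quotient.mk_surjective _ x
    obtain ⟨y, rfl⟩ := Submodule.Quotient.mk_surjective _ y
    have h : x + -y ∈ I ⊔ J := (Submodule.Quotient.mk_eq_zero _).1 hxy
    obtain ⟨i, hi, j, hj, hij⟩ := Submodule.mem_sup.1 h
    refine ⟨Submodule.Quotient.mk (x - i), Prod.ext ?_ ?_⟩
    · exact (Submodule.Quotient.eq I).2 (by simpa using hi)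
    · have : x - i - y = j := by linear_combination -hij
      exact (Submodule.Quotient.eq J).2 (by simpa [this] using hj)
  mono_f := by
    rw [ModuleCat.mono_iff_injective]
    refine (injective_iff_map_eq_zero (ModuleCat.Hom.hom (infSupShortComplex I J).f)).2 fun x hx => ?_
    obtain ⟨x, rfl⟩ := Submodule.Quotient.mk_surjective _ x
    have := Prod.ext_iff.1 hx
    exact (Submodule.Quotient.mk_eq_zero _).2
      ⟨(Submodule.Quotient.mk_eq_zero _).1 this.1, (Submodule.Quotient.mk_eq_zero _).1 this.2⟩
  epi_g := by
    rw [ModuleCat.epi_iff_surjective]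
    intro y
    obtain ⟨y, rfl⟩ := Submodule.Quotient.mk_surjective _ y
    exact ⟨(Submodule.Quotient.mk y, 0), by simp⟩

theorem hasProjectiveDimensionLT_quotient_sup {I J : Ideal R} (n : ℕ)
    (hI : HasProjectiveDimensionLT (ModuleCat.of R (R ⧸ I)) (n + 1))
    (hJ : HasProjectiveDimensionLT (ModuleCat.of R (R ⧸ J)) (n + 1))
    (hIJ : HasProjectiveDimensionLT (ModuleCat.of R (R ⧸ (I ⊓ J))) n) :
    HasProjectiveDimensionLT (ModuleCat.of R (R ⧸ (I ⊔ J))) (n + 1) :=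
  (infSupShortComplex_shortExact I J).hasProjectiveDimensionLT_X₃ n hIJ
    (ModuleCat.hasProjectiveDimensionLT_prod _ hI hJ)

end Ideal

open MvPolynomial

/-! ### Ideals generated by variables and edges. -/

namespace SimpleGraph

variable {V : Type*} (G : SimpleGraph V) (k : Type*) [Field k]

/-- The sum of the ideal generated by the variables in `A` and the edge ideal of the
subgraph of `G` induced on `W`. -/
noncomputable def varEdgeIdeal (A W : Set V) : Ideal (MvPolynomial V k) :=
  Ideal.span ((fun s => monomial s (1 : k)) ''
    {s | (∃ v ∈ A, s = Finsupp.single v 1) ∨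
      ∃ x ∈ W, ∃ y ∈ W, G.Adj x y ∧ s = Finsupp.single x 1 + Finsupp.single y 1})

variable {G k}

/-- The generators are squarefree monomials, so membership depends only on which variables occur in
each term. This turns ideal identities into combinatorics. -/
theorem mem_varEdgeIdeal {A W : Set V} {p : MvPolynomial V k} :
    p ∈ G.varEdgeIdeal k A W ↔ ∀ m ∈ p.support,
      (∃ v ∈ A, m v ≠ 0) ∨ ∃ x ∈ W, ∃ y ∈ W, G.Adj x y ∧ m x ≠ 0 ∧ m y ≠ 0 := by
  classical
  rw [varEdgeIdeal, mem_ideal_span_monomial_image]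
  refine forall₂_congr fun m _ => ⟨?_, ?_⟩
  · rintro ⟨s, ⟨v, hv, rfl⟩ | ⟨x, hx, y, hy, hxy, rfl⟩, hs⟩
    · have := hs v
      exact Or.inl ⟨v, hv, by simp at this; lia⟩
    · have h1 := hs x
      have h2 := hs y
      simp at h1 h2
      exact Or.inr ⟨x, hx, y, hy, hxy, by lia, by lia⟩
  · rintro (⟨v, hv, h⟩ | ⟨x, hx, y, hy, hxy, h1, h2⟩)
    · exact ⟨_, Or.inl ⟨v, hv, rfl⟩, by simpa [Nat.one_le_iff_ne_zero] using h⟩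
    · refine ⟨_, Or.inr ⟨x, hx, y, hy, hxy, rfl⟩, fun z => ?_⟩
      have := hxy.ne
      simp only [Finsupp.add_apply, Finsupp.single_apply]
      split_ifs <;> subst_vars <;> lia

theorem varEdgeIdeal_empty_univ : G.varEdgeIdeal k ∅ Set.univ = G.edgeIdeal k := by
  rw [varEdgeIdeal, edgeIdeal]
  congr 1
  ext p
  simp only [Set.mem_image, Set.mem_ofPred_eq, Set.mem_empty_iff_false, false_and, exists_false,
    Set.mem_univ, true_and, false_or, X]
  constructor
  · rintro ⟨_, ⟨x, y, h, rfl⟩, rfl⟩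
    exact ⟨x, y, h, by simp [monomial_mul]⟩
  · rintro ⟨x, y, h, rfl⟩
    exact ⟨_, ⟨x, y, h, rfl⟩, by simp [monomial_mul]⟩

theorem varEdgeIdeal_congr {A A' W W' : Set V} (hA : A = A')
    (hW : ∀ x y, G.Adj x y → (x ∈ W ∧ y ∈ W ↔ x ∈ W' ∧ y ∈ W')) :
    G.varEdgeIdeal k A W = G.varEdgeIdeal k A' W' := by
  subst hA
  ext p
  simp only [mem_varEdgeIdeal]
  refine forall₂_congr fun m _ => or_congr_right ?_
  constructor
  · rintro ⟨x, hx, y, hy, h, h'⟩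
    exact ⟨x, ((hW x y h).1 ⟨hx, hy⟩).1, y, ((hW x y h).1 ⟨hx, hy⟩).2, h, h'⟩
  · rintro ⟨x, hx, y, hy, h, h'⟩
    exact ⟨x, ((hW x y h).2 ⟨hx, hy⟩).1, y, ((hW x y h).2 ⟨hx, hy⟩).2, h, h'⟩

theorem X_mul_mem_varEdgeIdeal {A W : Set V} {v : V} (hvA : v ∉ A) (hvW : v ∈ W)
    (p : MvPolynomial V k) :
    X v * p ∈ G.varEdgeIdeal k A W ↔
      p ∈ G.varEdgeIdeal k (A ∪ (W ∩ G.neighborSet v)) (W \ insert v (G.neighborSet v)) := by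
  classical
  simp only [mem_varEdgeIdeal, support_X_mul, Finset.mem_map, forall_exists_index, and_imp,
    forall_apply_eq_imp_iff₂, addLeftEmbedding_apply]
  refine forall₂_congr fun m _ => ?_
  constructor
  · rintro (⟨u, hu, h⟩ | ⟨x, hx, y, hy, hxy, h1, h2⟩)
    · left
      refine ⟨u, Or.inl hu, ?_⟩
      have : v ≠ u := by rintro rfl; exact hvA hu
      simpa [Finsupp.single_apply, this] using h
    · by_cases hvx : v = x
      · subst hvx
        exact Or.inl ⟨y, Or.inr ⟨hy, hxy⟩, by simpa [Finsupp.single_apply, hxy.ne] using h2⟩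
      by_cases hvy : v = y
      · subst hvy
        exact Or.inl ⟨x, Or.inr ⟨hx, hxy.symm⟩, by simpa [Finsupp.single_apply, hvx] using h1⟩
      have h1 : m x ≠ 0 := by simpa [Finsupp.single_apply, hvx] using h1
      have h2 : m y ≠ 0 := by simpa [Finsupp.single_apply, hvy] using h2
      by_cases hax : G.Adj v x
      · exact Or.inl ⟨x, Or.inr ⟨hx, hax⟩, h1⟩
      by_cases hay : G.Adj v y
      · exact Or.inl ⟨y, Or.inr ⟨hy, hay⟩, h2⟩
      refine Or.inr ⟨x, ⟨hx, ?_⟩, y, ⟨hy, ?_⟩, hxy, h1, h2⟩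
      · simp [hax, Ne.symm hvx]
      · simp [hay, Ne.symm hvy]
  · rintro (⟨u, hu | ⟨hu, hvu⟩, h⟩ | ⟨x, hx, y, hy, hxy, h1, h2⟩)
    · exact Or.inl ⟨u, hu, by simp [h]⟩
    · exact Or.inr ⟨v, hvW, u, hu, hvu, by simp, by simp [h]⟩
    · exact Or.inr ⟨x, hx.1, y, hy.1, hxy, by simp [h1], by simp [h2]⟩

theorem varEdgeIdeal_sup_span_X (A W : Set V) (v : V) :
    G.varEdgeIdeal k A W ⊔ Ideal.span {X v} = G.varEdgeIdeal k (insert v A) (W \ {v}) := by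
  refine le_antisymm (sup_le (fun p hp => ?_) ?_) (Ideal.span_le.2 ?_)
  · rw [mem_varEdgeIdeal] at hp ⊢
    intro m hm
    rcases hp m hm with ⟨u, hu, h⟩ | ⟨x, hx, y, hy, hxy, h1, h2⟩
    · exact Or.inl ⟨u, Or.inr hu, h⟩
    by_cases h0 : m v = 0
    · exact Or.inr ⟨x, ⟨hx, fun h => h1 (h ▸ h0)⟩, y, ⟨hy, fun h => h2 (h ▸ h0)⟩, hxy, h1, h2⟩
    · exact Or.inl ⟨v, Or.inl rfl, h0⟩
  · rw [Ideal.span_singleton_le_iff_mem]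
    exact Ideal.subset_span ⟨_, Or.inl ⟨v, Or.inl rfl, rfl⟩, rfl⟩
  · rintro _ ⟨_, ⟨u, rfl | hu, rfl⟩ | ⟨x, hx, y, hy, hxy, rfl⟩, rfl⟩
    · exact Ideal.mem_sup_right (Ideal.mem_span_singleton_self _)
    · exact Ideal.mem_sup_left (Ideal.subset_span ⟨_, Or.inl ⟨u, hu, rfl⟩, rfl⟩)
    · exact Ideal.mem_sup_left
        (Ideal.subset_span ⟨_, Or.inr ⟨x, hx.1, y, hy.1, hxy, rfl⟩, rfl⟩)

theorem mem_varEdgeIdeal_empty {A : Set V} {p : MvPolynomial V k} :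
    p ∈ G.varEdgeIdeal k A ∅ ↔ ∀ m ∈ p.support, ∃ v ∈ A, m v ≠ 0 := by
  simp [mem_varEdgeIdeal]

theorem X_mul_mem_varEdgeIdeal_empty {A : Set V} {v : V} (hv : v ∉ A) (p : MvPolynomial V k) :
    X v * p ∈ G.varEdgeIdeal k A ∅ ↔ p ∈ G.varEdgeIdeal k A ∅ := by
  classical
  simp only [mem_varEdgeIdeal_empty, support_X_mul, Finset.mem_map, forall_exists_index, and_imp,
    forall_apply_eq_imp_iff₂, addLeftEmbedding_apply]
  refine forall₂_congr fun m _ => exists_congr fun u => and_congr_right fun hu => ?_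
  have : v ≠ u := by rintro rfl; exact hv hu
  simp [this]

theorem varEdgeIdeal_empty_empty : G.varEdgeIdeal k ∅ ∅ = ⊥ := by
  simp [varEdgeIdeal]

theorem varEdgeIdeal_empty_ne_top (A : Set V) : G.varEdgeIdeal k A ∅ ≠ ⊤ := by
  rw [Ideal.ne_top_iff_one, mem_varEdgeIdeal_empty]
  simp

theorem varEdgeIdeal_empty_sup_span_X (A : Set V) (v : V) :
    G.varEdgeIdeal k A ∅ ⊔ Ideal.span {X v} = G.varEdgeIdeal k (insert v A) ∅ := by
  rw [varEdgeIdeal_sup_span_X, Set.empty_sdiff]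

theorem edgeIdeal_le_varEdgeIdeal_univ : G.edgeIdeal k ≤ G.varEdgeIdeal k Set.univ ∅ := by
  rw [← varEdgeIdeal_empty_univ]
  intro p hp
  rw [mem_varEdgeIdeal] at hp ⊢
  intro m hm
  rcases hp m hm with ⟨u, hu, h⟩ | ⟨x, hx, y, hy, hxy, h1, h2⟩
  · exact hu.elim
  · exact Or.inl ⟨x, trivial, h1⟩

/-! ### Quotients by variables. -/

theorem hasProjectiveDimensionLT_quotient_varEdgeIdeal_empty (A : Finset V) :
    HasProjectiveDimensionLT
      (ModuleCat.of (MvPolynomial V k) (MvPolynomial V k ⧸ G.varEdgeIdeal k A ∅))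
      (A.card + 1) := by
  classical
  induction A using Finset.induction with
  | empty =>
    rw [Finset.coe_empty, varEdgeIdeal_empty_empty]
    exact Ideal.hasProjectiveDimensionLT_quotient_bot
  | insert v A hv ih =>
    rw [Finset.coe_insert, ← varEdgeIdeal_empty_sup_span_X, Finset.card_insert_of_notMem hv]
    exact Ideal.hasProjectiveDimensionLT_quotient_sup_span_singleton
      (X_mul_mem_varEdgeIdeal_empty (by simpa using hv)) _ ih

/-- The target is S/m, killed by every variable, so each new variable raises the degree of a nonzero
Ext class by one. -/
theorem nontrivial_ext_quotient_varEdgeIdeal_empty (A : Finset V) :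
    Nontrivial (Ext
      (ModuleCat.of (MvPolynomial V k) (MvPolynomial V k ⧸ G.varEdgeIdeal k A ∅))
      (ModuleCat.of (MvPolynomial V k) (MvPolynomial V k ⧸ G.varEdgeIdeal k Set.univ ∅))
      A.card) := by
  classical
  induction A using Finset.induction with
  | empty =>
    rw [Finset.coe_empty, varEdgeIdeal_empty_empty, Finset.card_empty]
    refine (Ext.homEquiv₀.nontrivial_congr).2 ⟨ModuleCat.ofHom (Submodule.factor bot_le), 0, ?_⟩
    intro h
    have h1 := congrArg (fun f => ModuleCat.Hom.hom f (Submodule.Quotient.mk 1)) h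
    exact varEdgeIdeal_empty_ne_top (G := G) (k := k) Set.univ
      ((Ideal.eq_top_iff_one _).2 ((Submodule.Quotient.mk_eq_zero _).1 h1))
  | insert v A hv ih =>
    rw [Finset.coe_insert, ← varEdgeIdeal_empty_sup_span_X, Finset.card_insert_of_notMem hv]
    refine Ideal.nontrivial_ext_quotient_sup_span_singleton
      (X_mul_mem_varEdgeIdeal_empty (by simpa using hv)) _ ?_ _ ih
    refine ModuleCat.hom_ext (LinearMap.ext fun x => ?_)
    obtain ⟨x, rfl⟩ := Submodule.Quotient.mk_surjective _ x
    refine (Submodule.Quotient.mk_eq_zero _).2 (Ideal.mul_mem_right x _ (Ideal.subset_span ?_))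
    exact ⟨_, Or.inl ⟨v, trivial, rfl⟩, rfl⟩

/-! ### The upper bound. -/

/-- `hM` is |A| + |W| - |W|/D < M cleared of denominators. -/
theorem hasProjectiveDimensionLT_quotient_varEdgeIdeal [Fintype V] [DecidableEq V]
    [DecidableRel G.Adj] {D : ℕ} (hD : 0 < D)
    (hG : ∀ x y, G.Adj x y → (G.neighborFinset x ∪ G.neighborFinset y).card ≤ D)
    (W A : Finset V) (hAW : Disjoint A W) (M : ℕ)
    (hM : D * (A.card + W.card) < W.card + D * M) :
    HasProjectiveDimensionLT
      (ModuleCat.of (MvPolynomial V k) (MvPolynomial V k ⧸ G.varEdgeIdeal k A W)) M := by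
  induction hn : W.card using Nat.strong_induction_on generalizing W A M with
  | _ n ih =>
  subst hn
  rcases W.eq_empty_or_nonempty with rfl | hW
  · have : A.card < M := by simpa [hD] using hM
    have := hasProjectiveDimensionLT_quotient_varEdgeIdeal_empty (G := G) (k := k) A
    rw [Finset.coe_empty]
    exact hasProjectiveDimensionLT_of_ge _ (A.card + 1) _ (by lia)
  obtain ⟨x, hx⟩ := hW
  let N := W.filter (G.Adj x)
  have hNW : N ⊆ W := Finset.filter_subset _ _
  have hxN : x ∉ N := by simp [N]
  have hxA : x ∉ A := fun h => Finset.disjoint_left.1 hAW h hx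
  have hND : N.card + 1 ≤ D := by
    rcases N.eq_empty_or_nonempty with h | ⟨v, hv⟩
    · simpa [h] using! hD
    · refine le_trans ?_ (hG x v (Finset.mem_filter.1 hv).2)
      rw [← Finset.card_insert_of_notMem hxN]
      refine Finset.card_le_card fun u hu => ?_
      rcases Finset.mem_insert.1 hu with rfl | hu
      · simp [(Finset.mem_filter.1 hv).2.symm]
      · simp [(Finset.mem_filter.1 hu).2]
  -- `U` is the set of neighbours of `x` not yet moved into `A`; U = N is the goal.
  suffices h : ∀ U ⊆ N, HasProjectiveDimensionLT (ModuleCat.of (MvPolynomial V k)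
      (MvPolynomial V k ⧸ G.varEdgeIdeal k ↑(A ∪ (N \ U)) ↑(W \ (N \ U)))) M by
    have := h N subset_rfl
    rwa [Finset.sdiff_self, Finset.union_empty, Finset.sdiff_empty] at this
  intro U
  induction U using Finset.induction with
  | empty =>
    intro _
    have hc : (W \ insert x N).card + (N.card + 1) = W.card := by
      rw [← Finset.card_insert_of_notMem hxN]
      exact Finset.card_sdiff_add_card_eq_card (Finset.insert_subset hx hNW)
    have hA : (A ∪ N).card ≤ A.card + N.card := Finset.card_union_le _ _
    have := ih (W \ insert x N).card (by lia) (W \ insert x N) (A ∪ N) ?_ M ?_ rfl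
    · rw [Finset.sdiff_empty]
      -- With `N` removed from `W`, `x` lies on no remaining edge.
      rw [varEdgeIdeal_congr rfl fun y z hyz => ?_]
      · exact this
      have := hyz.symm
      simp only [N, Finset.coe_sdiff, Finset.coe_insert, Set.mem_sdiff, Set.mem_insert_iff,
        Finset.mem_coe, Finset.mem_filter]
      by_cases h1 : y = x <;> by_cases h2 : z = x <;> subst_vars <;> simp_all
    · rw [Finset.disjoint_left] at hAW ⊢
      intro y hy
      have := @hAW y
      simp only [Finset.mem_union, Finset.mem_sdiff, Finset.mem_insert] at hy ⊢
      tauto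
    · have : D * ((A ∪ N).card + (W \ insert x N).card) + D ≤ D * (A.card + W.card) := by
        rw [← Nat.mul_succ]
        exact Nat.mul_le_mul_left _ (by lia)
      lia
  | insert v U hvU ih' =>
    intro hU
    have hvN : v ∈ N := hU (Finset.mem_insert_self _ _)
    have hxv : G.Adj x v := (Finset.mem_filter.1 hvN).2
    have hvW : v ∈ W := hNW hvN
    have hvA : v ∉ A := fun h => Finset.disjoint_left.1 hAW h hvW
    let T := N \ insert v U
    have hT : T ⊆ N := Finset.sdiff_subset
    have hvT : v ∉ T := by simp [T]
    have hT' : N \ U = insert v T := by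
      ext u
      simp only [T, Finset.mem_sdiff, Finset.mem_insert]
      by_cases h : u = v <;> simp_all
    refine Ideal.hasProjectiveDimensionLT_quotient_of_colon
      (X_mul_mem_varEdgeIdeal (v := v) ?_ ?_) _ ?_ ?_
    · simp [hvA]
    · simp [hvW]
    · let W' := (W \ T) \ insert v (G.neighborFinset v)
      let N' := (W \ T) ∩ G.neighborFinset v
      have e1 : ((A ∪ T : Finset V) : Set V) ∪ (((W \ T : Finset V) : Set V) ∩ G.neighborSet v)
          = ((A ∪ T ∪ N' : Finset V) : Set V) := by
        ext; simp [N', or_assoc]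
      have e2 : ((W \ T : Finset V) : Set V) \ insert v (G.neighborSet v) = (W' : Set V) := by
        ext; simp [W']
      -- Vertices moved earlier are neighbours of `x`, and so is `v`; this is where the edge degree
      -- of (x, v) enters.
      have hsub : W \ W' ⊆ G.neighborFinset x ∪ G.neighborFinset v := by
        intro u hu
        simp only [W', Finset.mem_sdiff, Finset.mem_insert, mem_neighborFinset,
          Finset.mem_union] at hu ⊢
        by_cases h1 : u ∈ T
        · exact Or.inl (Finset.mem_filter.1 (hT h1)).2
        · by_cases h2 : u = v
          · subst h2; exact Or.inl hxv
          · tauto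
      have hW'W : W' ⊆ W := Finset.sdiff_subset.trans Finset.sdiff_subset
      have hcard : W.card ≤ W'.card + D := by
        have h1 := Finset.card_sdiff_add_card_eq_card hW'W
        have h2 := (Finset.card_le_card hsub).trans (hG x v hxv)
        lia
      -- The 1 counts `v`, which lies in neither new set.
      have hcard' : (A ∪ T ∪ N').card + W'.card + 1 ≤ A.card + W.card := by
        have hvn : v ∉ A ∪ T ∪ N' ∪ W' := by simp [hvA, hvT, N', W']
        have hd : Disjoint (A ∪ T ∪ N') W' := by
          rw [Finset.disjoint_left] at hAW ⊢
          intro y hy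
          have := @hAW y
          simp only [N', W', Finset.mem_union, Finset.mem_sdiff, Finset.mem_insert,
            Finset.mem_inter] at hy ⊢
          tauto
        rw [← Finset.card_union_of_disjoint hd, ← Finset.card_insert_of_notMem hvn]
        refine le_trans (Finset.card_le_card ?_) (Finset.card_union_le A W)
        intro y hy
        have := @hNW y
        have := @hT y
        simp only [N', W', Finset.mem_union, Finset.mem_sdiff, Finset.mem_insert,
            Finset.mem_inter] at hy ⊢
        rcases hy with rfl | hy
        · exact Or.inr hvW
        · tauto
      have := ih W'.card ?_ W' (A ∪ T ∪ N') ?_ M ?_ rfl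
      · rw [← e1, ← e2] at this
        exact this
      · refine Finset.card_lt_card ⟨hW'W, fun h => ?_⟩
        simpa [W'] using h hvW
      · rw [Finset.disjoint_left] at hAW ⊢
        intro y hy
        have := @hAW y
        simp only [N', W', Finset.mem_union, Finset.mem_sdiff, Finset.mem_insert,
          Finset.mem_inter] at hy ⊢
        tauto
      · have : D * ((A ∪ T ∪ N').card + W'.card) + D ≤ D * (A.card + W.card) := by
          rw [← Nat.mul_succ]
          exact Nat.mul_le_mul_left _ (by lia)
        lia
    · have := ih' ((Finset.subset_insert _ _).trans hU)
      have e1 : insert v ((A ∪ T : Finset V) : Set V) = ((A ∪ N \ U : Finset V) : Set V) := by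
        rw [hT', Finset.union_insert, Finset.coe_insert]
      have e2 : ((W \ T : Finset V) : Set V) \ {v} = ((W \ (N \ U) : Finset V) : Set V) := by
        rw [hT', Finset.sdiff_insert, Finset.coe_erase]
      rw [varEdgeIdeal_sup_span_X, e1, e2]
      exact this

theorem exists_pdEdgeIdealQuotient_eq [Fintype V] [DecidableEq V]
    [DecidableRel G.Adj] {D : ℕ} (hD : G.IsMaxEdgeDegree D) :
    ∃ p : ℕ, G.pdEdgeIdealQuotient k = p ∧ D * p + Fintype.card V ≤ D * Fintype.card V := by
  obtain ⟨⟨x, y, hxy, hDxy⟩, hmax⟩ := hD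
  have hD0 : 0 < D := by
    rw [hDxy, edgeDegree_eq_card_union, Finset.card_pos]
    exact ⟨y, by simp [hxy]⟩
  have key : ∀ M : ℕ, D * Fintype.card V < Fintype.card V + D * M →
      HasProjectiveDimensionLT
        (ModuleCat.of (MvPolynomial V k) (MvPolynomial V k ⧸ G.edgeIdeal k)) M := by
    intro M hM
    have := hasProjectiveDimensionLT_quotient_varEdgeIdeal (G := G) (k := k) hD0
      (fun x y h => by
        rw [← edgeDegree_eq_card_union]
        exact hmax ⟨x, y, h, rfl⟩) Finset.univ ∅ (Finset.disjoint_empty_left _) M (by simpa using hM)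
    rwa [Finset.coe_empty, Finset.coe_univ, varEdgeIdeal_empty_univ] at this
  have hlt := key (Fintype.card V + 1) (by rw [Nat.mul_succ]; lia)
  obtain ⟨p, hp⟩ : ∃ p : ℕ, G.pdEdgeIdealQuotient k = p := by
    have hbot : G.pdEdgeIdealQuotient k ≠ ⊥ := by
      rw [pdEdgeIdealQuotient, ne_eq, projectiveDimension_eq_bot_iff,
        ModuleCat.isZero_iff_subsingleton, not_subsingleton_iff_nontrivial]
      exact Ideal.Quotient.nontrivial_iff.2 fun h =>
        varEdgeIdeal_empty_ne_top Set.univ (top_le_iff.1 (h ▸ edgeIdeal_le_varEdgeIdeal_univ))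
    have htop : G.pdEdgeIdealQuotient k ≠ ⊤ :=
      (projectiveDimension_ne_top_iff _).2 ⟨_, hlt⟩
    generalize G.pdEdgeIdealQuotient k = q at *
    induction q with
    | bot => exact absurd rfl hbot
    | coe q =>
      induction q with
      | top => exact absurd rfl htop
      | coe q => exact ⟨q, rfl⟩
  refine ⟨p, hp, ?_⟩
  by_contra! hlt'
  -- If the bound failed, `key` at M = p would give pd < p.
  have h := projectiveDimension_lt_iff.2 (key p (by lia))
  rw [pdEdgeIdealQuotient] at hp
  exact absurd h (by rw [hp]; exact lt_irrefl _)

/-! ### Complete bipartite graphs. -/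

theorem edgeDegree_completeBipartiteGraph {V W : Type*} [Fintype V] [Fintype W] [DecidableEq V]
    [DecidableEq W] [DecidableRel (completeBipartiteGraph V W).Adj] {x y : V ⊕ W}
    (h : (completeBipartiteGraph V W).Adj x y) :
    (completeBipartiteGraph V W).edgeDegree x y = Fintype.card V + Fintype.card W := by
  rw [edgeDegree_eq_card_union, ← Fintype.card_sum, ← Finset.card_univ]
  congr 1
  ext z
  rcases x with x | x <;> rcases y with y | y <;> rcases z with z | z <;> simp_all

theorem edgeIdeal_completeBipartiteGraph (V W : Type*) :
    (completeBipartiteGraph V W).edgeIdeal k =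
      (completeBipartiteGraph V W).varEdgeIdeal k (Set.range Sum.inl) ∅ ⊓
        (completeBipartiteGraph V W).varEdgeIdeal k (Set.range Sum.inr) ∅ := by
  rw [← varEdgeIdeal_empty_univ]
  ext p
  simp only [Ideal.mem_inf, mem_varEdgeIdeal, ← forall₂_and]
  refine forall₂_congr fun m _ => ?_
  simp only [Set.mem_empty_iff_false, false_and, exists_false, false_or, or_false, Set.mem_univ,
    true_and, Set.exists_range_iff, completeBipartiteGraph_adj]
  constructor
  · rintro ⟨x, y, hxy, h1, h2⟩
    rcases x with x | x <;> rcases y with y | y <;> simp at hxy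
    · exact ⟨⟨x, h1⟩, ⟨y, h2⟩⟩
    · exact ⟨⟨y, h2⟩, ⟨x, h1⟩⟩
  · rintro ⟨⟨x, h1⟩, ⟨y, h2⟩⟩
    exact ⟨_, _, by simp, h1, h2⟩

theorem varEdgeIdeal_empty_sup (A B : Set V) :
    G.varEdgeIdeal k A ∅ ⊔ G.varEdgeIdeal k B ∅ = G.varEdgeIdeal k (A ∪ B) ∅ := by
  simp only [varEdgeIdeal, ← Ideal.span_union, ← Set.image_union]
  congr 2
  ext s
  simp [or_and_right, exists_or]

theorem not_hasProjectiveDimensionLT_completeBipartiteGraph (V W : Type*) [Fintype V] [Fintype W]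
    [Nonempty V] [Nonempty W] {n : ℕ} (hn : n + 1 ≤ Fintype.card V + Fintype.card W)
    (h : HasProjectiveDimensionLT (ModuleCat.of (MvPolynomial (V ⊕ W) k)
      (MvPolynomial (V ⊕ W) k ⧸ (completeBipartiteGraph V W).edgeIdeal k)) n) : False := by
  classical
  have hV : 0 < Fintype.card V := Fintype.card_pos
  have hW : 0 < Fintype.card W := Fintype.card_pos
  obtain ⟨m, hm⟩ : ∃ m, m + 1 = Fintype.card V + Fintype.card W := ⟨_, Nat.sub_add_cancel (by lia)⟩
  replace h := hasProjectiveDimensionLT_of_ge (ModuleCat.of (MvPolynomial (V ⊕ W) k)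
    (MvPolynomial (V ⊕ W) k ⧸ (completeBipartiteGraph V W).edgeIdeal k)) n m (by lia)
  have hl := hasProjectiveDimensionLT_quotient_varEdgeIdeal_empty
    (G := completeBipartiteGraph V W) (k := k) (Finset.univ.map Function.Embedding.inl)
  have hr := hasProjectiveDimensionLT_quotient_varEdgeIdeal_empty
    (G := completeBipartiteGraph V W) (k := k) (Finset.univ.map Function.Embedding.inr)
  rw [edgeIdeal_completeBipartiteGraph] at h
  have el : ((Finset.univ.map Function.Embedding.inl : Finset (V ⊕ W)) : Set (V ⊕ W)) =
      Set.range Sum.inl := by ext; simp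
  have er : ((Finset.univ.map Function.Embedding.inr : Finset (V ⊕ W)) : Set (V ⊕ W)) =
      Set.range Sum.inr := by ext; simp
  rw [el, Finset.card_map, Finset.card_univ] at hl
  rw [er, Finset.card_map, Finset.card_univ] at hr
  -- Both sides are nonempty, so each has at most `m` vertices, and the sum of the two ideals would
  -- have pd at most `m`.
  have := Ideal.hasProjectiveDimensionLT_quotient_sup m
    (hasProjectiveDimensionLT_of_ge _ (Fintype.card V + 1) _ (by lia))
    (hasProjectiveDimensionLT_of_ge _ (Fintype.card W + 1) _ (by lia)) h
  rw [varEdgeIdeal_empty_sup, Set.range_inl_union_range_inr] at this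
  have hE := nontrivial_ext_quotient_varEdgeIdeal_empty
    (G := completeBipartiteGraph V W) (k := k) Finset.univ
  rw [Finset.coe_univ, Finset.card_univ, Fintype.card_sum] at hE
  exact not_subsingleton_iff_nontrivial.2 hE
    (HasProjectiveDimensionLT.subsingleton _ (m + 1) _ hm.le _)

end SimpleGraph

theorem mainTheorem4 (k : Type*) [Field k] :
    (∀ (V : Type*) [Fintype V] [DecidableEq V] (G : SimpleGraph V) [DecidableRel G.Adj] (D : ℕ),
      G.IsMaxEdgeDegree D →
        ∃ p : ℕ, G.pdEdgeIdealQuotient k = p ∧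
          (p : ℝ) ≤ (Fintype.card V : ℝ) * (1 - 1 / (D : ℝ))) ∧
    (∀ (a b : ℕ) [DecidableRel (completeBipartiteGraph (Fin a) (Fin b)).Adj],
      0 < a → 0 < b →
      (completeBipartiteGraph (Fin a) (Fin b)).IsMaxEdgeDegree (a + b) ∧
        ∃ p : ℕ, (completeBipartiteGraph (Fin a) (Fin b)).pdEdgeIdealQuotient k = p ∧
          (p : ℝ) = (Fintype.card (Fin a ⊕ Fin b) : ℝ) * (1 - 1 / ((a + b : ℕ) : ℝ))) := by
  refine ⟨?_, ?_⟩
  · intro V _ _ G _ D hD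
    obtain ⟨p, hp, hle⟩ := SimpleGraph.exists_pdEdgeIdealQuotient_eq (k := k) hD
    refine ⟨p, hp, ?_⟩
    have hD0 : 0 < D := by
      obtain ⟨⟨x, y, hxy, hDxy⟩, -⟩ := hD
      rw [hDxy, SimpleGraph.edgeDegree_eq_card_union, Finset.card_pos]
      exact ⟨y, by simp [hxy]⟩
    have hD0' : (0 : ℝ) < D := by exact_mod_cast hD0
    have hle' : (D : ℝ) * p + Fintype.card V ≤ D * Fintype.card V := by exact_mod_cast hle
    have : (Fintype.card V : ℝ) * (1 - 1 / (D : ℝ)) = (D * Fintype.card V - Fintype.card V) / D := by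
      field_simp
    rw [this, le_div_iff₀ hD0']
    linarith
  · intro a b _ ha hb
    have : Nonempty (Fin a) := ⟨⟨0, ha⟩⟩
    have : Nonempty (Fin b) := ⟨⟨0, hb⟩⟩
    have hmax : (completeBipartiteGraph (Fin a) (Fin b)).IsMaxEdgeDegree (a + b) := by
      refine ⟨⟨Sum.inl ⟨0, ha⟩, Sum.inr ⟨0, hb⟩, by simp, ?_⟩, ?_⟩
      · rw [SimpleGraph.edgeDegree_completeBipartiteGraph (by simp)]
        simp
      · rintro _ ⟨x, y, hxy, rfl⟩
        rw [SimpleGraph.edgeDegree_completeBipartiteGraph hxy]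
        simp
    refine ⟨hmax, ?_⟩
    obtain ⟨p, hp, hle⟩ := SimpleGraph.exists_pdEdgeIdealQuotient_eq (k := k) hmax
    refine ⟨p, hp, ?_⟩
    simp only [Fintype.card_sum, Fintype.card_fin] at hle ⊢
    have hlow : a + b ≤ p + 1 := by
      by_contra! hlt
      refine SimpleGraph.not_hasProjectiveDimensionLT_completeBipartiteGraph (k := k) (Fin a) (Fin b)
        (n := p + 1) (by simpa using hlt) ?_
      exact (projectiveDimension_le_iff _ _).1 hp.le
    -- Here n = D = a + b, so a factor a + b cancels from `hle`.
    have hupp : p + 1 ≤ a + b := by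
      refine le_of_mul_le_mul_left (a := a + b) ?_ (Nat.add_pos_left ha b)
      rwa [Nat.mul_succ]
    have hpe : (p : ℝ) + 1 = a + b := by exact_mod_cast le_antisymm hupp hlow
    have hpos : (0 : ℝ) < a + b := by exact_mod_cast (by lia : 0 < a + b)
    push_cast
    field_simp
    linarith
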